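/- Let $X=[0,1]^{\mathbb N_0}$, with the metric $d_X(\underline x,\underline y)=\sum_{i\ge 0}|x_i-y_i|/2^{i+1}$ and its topology, and let $\sigma:X\to X$, $\sigma(\underline x)_i=x_{i+1}$, be the shift. For $\varphi:X\to\mathbb R$ Lipschitz continuous let $\alpha_\varphi=\inf_\mu\int\varphi\,d\mu$, the infimum over all $\sigma$-invariant Borel probability measures $\mu$ on $X$; for $\underline x,\underline y\in X$ and $\varepsilon>0$ let $$S_\varphi(\underline x,\underline y;\varepsilon)=\inf\Big\{\sum_{i=0}^{n-1}\big(\varphi(\sigma^i\underline z)-\alpha_\varphi\big)\ \Big|\ n\ge 1,\ \underline z\in X,\ d_X(\underline x,\underline z)<\varepsilon,\ d_X(\sigma^n\underline z,\underline y)<\varepsilon\Big\}$$ and let $S_\varphi(\underline x,\underline y)=\lim_{\varepsilon\to0+}S_\varphi(\underline x,\underline y;\varepsilon)$ be the Mañé potential. The orbit $\{\sigma^n(\underline x)\}_{n\ge0}$ is $\varphi$-semi-static if $\sum_{n=i}^{j-1}(\varphi(\sigma^n\underline x)-\alpha_\varphi)=S_\varphi(\sigma^i\underline x,\sigma^j\underline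 x)$ for all integers $0\le i<j$. The Mañé set is $$N_\varphi=\{\sigma^k(\underline x)\mid k\in\mathbb N_0,\ \{\sigma^n(\underline x)\}_{n\ge0}\ \text{is }\varphi\text{-semi-static}\}.$$ Let $h:[0,1]^2\to\mathbb R$ satisfy (A) or (B): (A) $h$ is of class $C^2$ on $[0,1]^2$ and $D_2D_1h<0$ on $[0,1]^2$; (B) $h$ is Lipschitz continuous; $h(\xi_1,\eta_1)+h(\xi_2,\eta_2)<h(\xi_1,\eta_2)+h(\xi_2,\eta_1)$ whenever $\xi_1<\xi_2$ and $\eta_1<\eta_2$; and $(a-a')(c-c')<0$ whenever $(a,b,c)\ne(a',b,c')$ are both minimal, where $(a,b,c)\in[0,1]^3$ is minimal if $h(a,b)+h(b,c)\le h(a,y)+h(y,c)$ for all $y\in[0,1]$. Put $\varphi(\underline x)=h(x_0,x_1)$ for $\underline x\in X$, $h^*=\min_{a\in[0,1]}h(a,a)$, $\mathrm m_h=\{a\in[0,1]\mid h(a,a)=h^*\}$, and $a^\infty=aaa\ldots\in X$. Then $$N_\varphi=\{\underline x\in X\mid\sigma^i(\underline x)\ne\sigma^j(\underline x)\ \text{if}\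 i\ne j\}\ \cup\ \bigcup_{M\in\mathbb N_0}\sigma^{-M}\big(\{a^\infty\mid a\in\mathrm m_h\}\big),$$ and $N_\varphi$ is dense in $X$. Moreover, there is an $h$ satisfying (A) such that, for $\varphi(\underline x)=h(x_0,x_1)$, the set $N_\varphi$ is not closed in $X$. -/

import Mathlib

open MeasureTheory Filter Topology

namespace XYModel

/-- The phase space `X = [0,1]^{ℕ₀}`. Its product topology is the topology of the metric `dX`
below, and its product σ-algebra is the Borel σ-algebra of that topology. -/
abbrev X : Type := ℕ → unitInterval

/-- The metric `d_X(x, y) = ∑ |x_i - y_i| / 2^{i+1}` (the series always converges). -/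
noncomputable def dX (x y : X) : ℝ :=
  ∑' i : ℕ, |(x i : ℝ) - (y i : ℝ)| / 2 ^ (i + 1)

/-- The shift map `(shift x)_i = x_{i+1}`. -/
def shift (x : X) : X := fun i => x (i + 1)

/-- The fixed point `a^∞`. -/
def const (a : unitInterval) : X := fun _ => a

/-- The shift-invariant Borel probability measures on `X`. -/
def invariantMeasures : Set (Measure X) :=
  {μ | IsProbabilityMeasure μ ∧ MeasurePreserving shift μ μ}

/-- The optimal ergodic average `α_φ = inf_μ ∫ φ dμ` over the invariant Borel probability
measures. -/
noncomputable def alpha (φ : X → ℝ) : ℝ :=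
  sInf ((fun μ : Measure X => ∫ x, φ x ∂μ) '' invariantMeasures)

/-- `B(x, y, n; ε)`. -/
def B (x y : X) (n : ℕ) (ε : ℝ) : Set X :=
  {z | dX x z < ε ∧ dX (shift^[n] z) y < ε}

/-- `S_φ(x, y; ε)`: the infimum of the normalised Birkhoff sums of length `n ≥ 1` over
`z ∈ B(x, y, n; ε)`, as an extended real. -/
noncomputable def maneEps (φ : X → ℝ) (x y : X) (ε : ℝ) : EReal :=
  sInf {s : EReal | ∃ n : ℕ, 1 ≤ n ∧ ∃ z ∈ B x y n ε,
    s = ((∑ i ∈ Finset.range n, (φ (shift^[i] z) - alpha φ) : ℝ) : EReal)}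

/-- The Mañé potential `S_φ(x, y) = lim_{ε → 0+} S_φ(x, y; ε)`. The limit always exists in the
extended reals, see `tendsto_maneEps`. -/
noncomputable def manePotential (φ : X → ℝ) (x y : X) : EReal :=
  limUnder (𝓝[>] (0 : ℝ)) (fun ε => maneEps φ x y ε)

theorem maneEps_antitone (φ : X → ℝ) (x y : X) : Antitone (maneEps φ x y) := by
  intro ε δ hεδ
  apply sInf_le_sInf
  rintro s ⟨n, hn, z, hz, rfl⟩
  exact ⟨n, hn, z, ⟨hz.1.trans_le hεδ, hz.2.trans_le hεδ⟩, rfl⟩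

theorem tendsto_maneEps (φ : X → ℝ) (x y : X) :
    Tendsto (maneEps φ x y) (𝓝[>] (0 : ℝ)) (𝓝 (manePotential φ x y)) :=
  tendsto_nhds_limUnder ⟨_, (maneEps_antitone φ x y).tendsto_nhdsGT 0⟩

/-- The positive semi-orbit of `x` is `φ`-semi-static. -/
def SemiStatic (φ : X → ℝ) (x : X) : Prop :=
  ∀ i j : ℕ, i < j →
    ((∑ n ∈ Finset.Ico i j, (φ (shift^[n] x) - alpha φ) : ℝ) : EReal)
      = manePotential φ (shift^[i] x) (shift^[j] x)

/-- The Mañé set `N_φ`. -/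
def maneSet (φ : X → ℝ) : Set X :=
  {y | ∃ (x : X) (k : ℕ), SemiStatic φ x ∧ y = shift^[k] x}

/-- `h^* = min_{a ∈ [0,1]} h(a, a)` (the minimum is attained for continuous `h`). -/
noncomputable def hStar (h : ℝ → ℝ → ℝ) : ℝ := ⨅ a : unitInterval, h a a

/-- `m_h = {a ∈ [0,1] | h(a, a) = h^*}`. -/
def mSet (h : ℝ → ℝ → ℝ) : Set unitInterval := {a | h a a = hStar h}

/-- The unit square in `ℝ × ℝ`. -/
def square : Set (ℝ × ℝ) := Set.Icc (0 : ℝ) 1 ×ˢ Set.Icc (0 : ℝ) 1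

/-- `h` is of class `C²` on `[0,1]²` with the twist condition `D₂ D₁ h < 0` there (one-sided
derivatives at the boundary). Only the values of `h` on the square matter. -/
def TwistC2 (h : ℝ → ℝ → ℝ) : Prop :=
  ContDiffOn ℝ 2 (fun p : ℝ × ℝ => h p.1 p.2) square ∧
  ∀ x ∈ Set.Icc (0 : ℝ) 1, ∀ y ∈ Set.Icc (0 : ℝ) 1,
    derivWithin (fun t => derivWithin (fun s => h s t) (Set.Icc 0 1) x) (Set.Icc 0 1) y < 0

/-- The word `a b c` is minimal: `b` minimises the action among words with the same ends. -/
def MinimalTriple (h : ℝ → ℝ → ℝ) (a b c : unitInterval) : Prop :=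
  ∀ y : unitInterval, h a b + h b c ≤ h a y + h y c

/-- `h` is Lipschitz on `[0,1]²`, satisfies the strict exchange inequality, and two different
minimal words of length three with the same middle letter cross. -/
def TwistLip (h : ℝ → ℝ → ℝ) : Prop :=
  (∃ K, LipschitzOnWith K (fun p : ℝ × ℝ => h p.1 p.2) square) ∧
  (∀ ξ₁ ξ₂ η₁ η₂ : unitInterval, ξ₁ < ξ₂ → η₁ < η₂ → h ξ₁ η₁ + h ξ₂ η₂ < h ξ₁ η₂ + h ξ₂ η₁) ∧
  (∀ a b c a' c' : unitInterval, MinimalTriple h a b c → MinimalTriple h a' b c' →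
    (a, c) ≠ (a', c') → ((a : ℝ) - a') * ((c : ℝ) - c') < 0)

end XYModel

/-!
Everything rests on a rearrangement inequality, `StrictExchange.sum_diag_le_sum_perm`: if `h`
satisfies the strict exchange inequality, a cycle `x₀, …, xₙ = x₀` costs at least
`∑ h(xᵢ, xᵢ) ≥ n h^*`, with equality only for constant cycles. Both classes of functions satisfy
the exchange inequality and are continuous on the square, and no other property of them is used.

Closing up an orbit segment changes its Birkhoff sum by a bounded amount, so `h^*` is a lower bound
for all ergodic averages; it is attained at `a^∞` for `a ∈ m_h`, whence `α_φ = h^*`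
(`alpha_eq_hStar`).

Let `y = σ^m x`, and let `z` shadow `x` up to a small `ε`, with `σ^n z` close to `y`. If `n ≥ m`,
the first `m` steps of `z` cost about as much as those of `x`, and the remaining ones nearly form a
cycle, so that their cost is almost nonnegative. If `n < m`, then `σ^n x = y` once `ε` is small.
Hence an orbit is semi-static as soon as all cycles in it have zero action
(`semiStatic_of_cycles`), which is vacuous for an injective orbit and clear for one that ends in
`a^∞` with `a ∈ m_h`. Conversely a cycle in a semi-static orbit has zero action, because going
around it once or twice connects the same points (`SemiStatic.sum_cycle_eq_zero`); by the equality
case of the rearrangement inequality it is a fixed point `a^∞` with `a ∈ m_h`.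

The sequences that end in `a^∞`, for one `a ∈ m_h`, are already dense. So the Mañé set is closed
only if it is all of `X`; for `h(s, t) = -st`, where `m_h = {1}`, it misses `0^∞`.
-/

namespace XYModel

/-! ### Rearrangement under the twist condition -/

/-- The strict exchange inequality (twist condition): uncrossing two pairs lowers the cost. -/
def StrictExchange {α : Type*} [LinearOrder α] (g : α → α → ℝ) : Prop :=
  ∀ ξ₁ ξ₂ η₁ η₂ : α, ξ₁ < ξ₂ → η₁ < η₂ → g ξ₁ η₁ + g ξ₂ η₂ < g ξ₁ η₂ + g ξ₂ η₁

theorem StrictExchange.le {α : Type*} [LinearOrder α] {g : α → α → ℝ} (hg : StrictExchange g)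
    {ξ₁ ξ₂ η₁ η₂ : α} (hξ : ξ₁ ≤ ξ₂) (hη : η₁ ≤ η₂) :
    g ξ₁ η₁ + g ξ₂ η₂ ≤ g ξ₁ η₂ + g ξ₂ η₁ := by
  rcases hξ.eq_or_lt with rfl | hξ
  · exact (add_comm _ _).le
  rcases hη.eq_or_lt with rfl | hη
  · exact le_rfl
  exact (hg _ _ _ _ hξ hη).le

/-- Rearrangement inequality: among all matchings of a finite family with itself the identity is
the cheapest, and a matching that is equally cheap only pairs equal values. -/
theorem StrictExchange.sum_diag_le_sum_perm {α ι : Type*} [LinearOrder α] [DecidableEq ι]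
    {g : α → α → ℝ} (hg : StrictExchange g) (x : ι → α) (s : Finset ι) :
    ∀ σ : Equiv.Perm ι, (∀ i, σ i ≠ i → i ∈ s) →
      ∑ i ∈ s, g (x i) (x i) ≤ ∑ i ∈ s, g (x i) (x (σ i)) ∧
      (∑ i ∈ s, g (x i) (x (σ i)) ≤ ∑ i ∈ s, g (x i) (x i) → ∀ i ∈ s, x (σ i) = x i) := by
  induction s using Finset.induction_on_max_value x with
  | empty => simp
  | insert a s has hmax ih =>
    intro σ hσ
    rw [Finset.sum_insert has, Finset.sum_insert has]
    by_cases ha : σ a = a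
    · have hσs : ∀ i, σ i ≠ i → i ∈ s := fun i hi =>
        (Finset.mem_insert.1 (hσ i hi)).resolve_left (by rintro rfl; exact hi ha)
      obtain ⟨h1, h2⟩ := ih σ hσs
      rw [ha]
      refine ⟨by linarith, fun h i hi => ?_⟩
      rcases Finset.mem_insert.1 hi with rfl | hi
      · rw [ha]
      · exact h2 (by linarith) i hi
    · -- Short-cut the index `a` of the largest value: its predecessor `b` is sent to `σ a`.
      set b := σ.symm a with hb
      have hσb : σ b = a := by simp [hb]
      have hba : b ≠ a := fun h => ha (by rw [← h, hσb, h])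
      have hbs : b ∈ s :=
        (Finset.mem_insert.1 (hσ b (by rw [hσb]; exact hba.symm))).resolve_left hba
      have hcs : σ a ∈ s :=
        (Finset.mem_insert.1 (hσ (σ a) (fun h => ha (σ.injective h)))).resolve_left ha
      set τ : Equiv.Perm ι := σ.trans (Equiv.swap a (σ a)) with hτ
      have hτa : τ a = a := by simp [hτ]
      have hτb : τ b = σ a := by simp [hτ, hσb]
      have hτi : ∀ i, i ≠ a → i ≠ b → τ i = σ i := by
        intro i hia hib
        have h1 : σ i ≠ a := fun h => hib (σ.injective (h.trans hσb.symm))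
        have h2 : σ i ≠ σ a := fun h => hia (σ.injective h)
        simp [hτ, Equiv.swap_apply_of_ne_of_ne h1 h2]
      have hτs : ∀ i, τ i ≠ i → i ∈ s := by
        intro i hi
        by_cases hia : i = a
        · exact absurd (hia ▸ hτa) hi
        by_cases hib : i = b
        · exact hib ▸ hbs
        rw [hτi i hia hib] at hi
        exact (Finset.mem_insert.1 (hσ i hi)).resolve_left hia
      obtain ⟨h1, h2⟩ := ih τ hτs
      have e1 := Finset.add_sum_erase s (fun i => g (x i) (x (σ i))) hbs
      have e2 := Finset.add_sum_erase s (fun i => g (x i) (x (τ i))) hbs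
      have e3 : ∑ i ∈ s.erase b, g (x i) (x (τ i)) = ∑ i ∈ s.erase b, g (x i) (x (σ i)) := by
        refine Finset.sum_congr rfl fun i hi => ?_
        rw [hτi i (fun h => has (h ▸ Finset.mem_of_mem_erase hi)) (Finset.ne_of_mem_erase hi)]
      simp only [hσb, hτb] at e1 e2
      have hex := hg.le (hmax b hbs) (hmax _ hcs)
      refine ⟨by linarith, fun h => ?_⟩
      have hfix := h2 (by linarith)
      have hcb : x (σ a) = x b := by rw [← hτb, hfix b hbs]
      have hxb : x b = x a := by
        by_contra hne
        have hlt := lt_of_le_of_ne (hmax b hbs) hne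
        have := hg _ _ _ _ hlt (hcb ▸ hlt : x (σ a) < x a)
        linarith
      intro i hi
      by_cases hia : i = a
      · rw [hia, hcb, hxb]
      by_cases hib : i = b
      · rw [hib, hσb, hxb]
      rw [← hτi i hia hib, hfix i ((Finset.mem_insert.1 hi).resolve_left hia)]

theorem StrictExchange.sum_diag_le_sum_cycle {α : Type*} [LinearOrder α]
    {g : α → α → ℝ} (hg : StrictExchange g) (x : ℕ → α) {n : ℕ} (hx : x n = x 0) :
    ∑ i ∈ Finset.range n, g (x i) (x i) ≤ ∑ i ∈ Finset.range n, g (x i) (x (i + 1)) ∧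
    (∑ i ∈ Finset.range n, g (x i) (x (i + 1)) ≤ ∑ i ∈ Finset.range n, g (x i) (x i) →
      ∀ i < n, x (i + 1) = x i) := by
  rcases n with _ | k
  · simp
  have hrot : ∀ i : Fin (k + 1), x (finRotate (k + 1) i : Fin (k + 1)) = x (i + 1) := by
    intro i
    by_cases hi : i = Fin.last k
    · subst hi
      simp [hx]
    · rw [coe_finRotate_of_ne_last hi]
  have := hg.sum_diag_le_sum_perm (fun i : Fin (k + 1) => x i) Finset.univ (finRotate (k + 1))
    (fun i _ => Finset.mem_univ i)
  simp only [hrot] at this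
  rw [Finset.sum_range, Finset.sum_range]
  exact ⟨this.1, fun h i hi => this.2 h ⟨i, hi⟩ (Finset.mem_univ _)⟩

/-- A path costs at least `-C`, where `C` bounds the price of closing it up. -/
theorem StrictExchange.neg_le_sum_path {α : Type*} [LinearOrder α]
    {g : α → α → ℝ} (hg : StrictExchange g) {c C : ℝ} (hc : ∀ a, c ≤ g a a) (z : ℕ → α) (n : ℕ)
    (hC₀ : 0 ≤ C) (hC : ∀ a, g a (z 0) ≤ g a (z n) + C) :
    -C ≤ ∑ i ∈ Finset.range n, (g (z i) (z (i + 1)) - c) := by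
  rcases n with _ | k
  · simpa using hC₀
  set w : ℕ → α := Function.update z (k + 1) (z 0) with hw
  have hwz : ∀ i, i ≠ k + 1 → w i = z i := fun i hi => by simp [hw, hi]
  have hw0 : w (k + 1) = w 0 := by simp [hw]
  have h1 := (hg.sum_diag_le_sum_cycle w hw0).1
  have h2 : ∑ i ∈ Finset.range (k + 1), c ≤ ∑ i ∈ Finset.range (k + 1), g (w i) (w i) :=
    Finset.sum_le_sum fun i _ => hc _
  have h3 : ∑ i ∈ Finset.range k, g (w i) (w (i + 1))
      = ∑ i ∈ Finset.range k, g (z i) (z (i + 1)) := by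
    refine Finset.sum_congr rfl fun i hi => ?_
    have := Finset.mem_range.1 hi
    rw [hwz i (by omega), hwz (i + 1) (by omega)]
  rw [Finset.sum_range_succ (fun i => g (w i) (w (i + 1))), h3, hw0, hwz k (by omega),
    hwz 0 (by omega)] at h1
  rw [Finset.sum_sub_distrib, Finset.sum_range_succ]
  linarith [hC (z k)]

/-! ### The shift and the metric -/

theorem shift_iterate_apply (x : X) (n i : ℕ) : shift^[n] x i = x (n + i) := by
  induction n generalizing x i with
  | zero => simp
  | succ n ih =>
    rw [Function.iterate_succ_apply, ih]
    exact congrArg x (by omega)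

theorem shift_iterate_add (x : X) (m n : ℕ) : shift^[m + n] x = shift^[m] (shift^[n] x) :=
  Function.iterate_add_apply _ _ _ _

theorem continuous_shift : Continuous shift :=
  continuous_pi fun i => continuous_apply (i + 1)

theorem shift_iterate_const (a : unitInterval) (n : ℕ) : shift^[n] (const a) = const a := by
  funext i
  rw [shift_iterate_apply]
  rfl

theorem dX_self (x : X) : dX x x = 0 := by simp [dX]

theorem abs_sub_le_dX (x z : X) (k : ℕ) : |(x k : ℝ) - z k| ≤ 2 ^ (k + 1) * dX x z := by
  have hb : ∀ i, |(x i : ℝ) - z i| ≤ 1 := fun i => by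
    rw [abs_le]
    constructor <;> linarith [(x i).2.1, (x i).2.2, (z i).2.1, (z i).2.2]
  have hs : Summable fun i : ℕ => |(x i : ℝ) - z i| / 2 ^ (i + 1) := by
    refine Summable.of_nonneg_of_le (fun i => by positivity) (fun i => ?_)
      ((summable_nat_add_iff 1).2 summable_geometric_two)
    rw [one_div, inv_pow, div_eq_mul_inv]
    exact mul_le_of_le_one_left (by positivity) (hb i)
  have := hs.le_tsum k (fun i _ => by positivity)
  rw [div_le_iff₀ (by positivity)] at this
  rw [mul_comm]
  exact this

/-! ### The optimal ergodic average -/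

theorem exists_mem_mSet {h : ℝ → ℝ → ℝ}
    (hc : Continuous fun p : unitInterval × unitInterval => h p.1 p.2) :
    (∃ a, a ∈ mSet h) ∧ ∀ a : unitInterval, hStar h ≤ h a a := by
  have hd : Continuous fun a : unitInterval => h a a :=
    hc.comp (continuous_id.prodMk continuous_id)
  have hle : ∀ a : unitInterval, hStar h ≤ h a a :=
    fun a => ciInf_le (isCompact_range hd).bddBelow a
  obtain ⟨a, -, ha⟩ := isCompact_univ.exists_isMinOn Set.univ_nonempty hd.continuousOn
  exact ⟨⟨a, le_antisymm (le_ciInf fun b => ha (Set.mem_univ b)) (hle a)⟩, hle⟩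

/-- The optimal average is attained at a fixed point: closing up orbit segments bounds the
Birkhoff averages below by `hStar h`, up to an error which tends to zero. -/
theorem alpha_eq_hStar {h : ℝ → ℝ → ℝ} {φ : X → ℝ} (hφ : ∀ x, φ x = h (x 0) (x 1))
    (hc : Continuous fun p : unitInterval × unitInterval => h p.1 p.2)
    (hg : StrictExchange fun a b : unitInterval => h a b) : alpha φ = hStar h := by
  obtain ⟨⟨a, ha⟩, hle⟩ := exists_mem_mSet hc
  have hφc : Continuous φ := by
    rw [show φ = fun x : X => h (x 0) (x 1) from funext hφ]
    exact hc.comp (f := fun x : X => (x 0, x 1))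
      ((continuous_apply 0).prodMk (continuous_apply 1))
  obtain ⟨K, hK⟩ := (isCompact_range hc).isBounded.exists_norm_le
  have hK' : ∀ a b : unitInterval, |h a b| ≤ K := fun a b => hK _ ⟨(a, b), rfl⟩
  have hK0 : 0 ≤ K := (abs_nonneg _).trans (hK' 0 0)
  have hshift : Measurable shift := continuous_shift.measurable
  have hdirac : Measure.dirac (const a) ∈ invariantMeasures := by
    refine ⟨inferInstance, hshift, ?_⟩
    exact Measure.map_dirac' hshift (const a)
  have hlow : ∀ μ ∈ invariantMeasures, hStar h ≤ ∫ x, φ x ∂μ := by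
    rintro μ ⟨hμ, hinv⟩
    have hint : Integrable φ μ := Integrable.of_bound hφc.aestronglyMeasurable K
      (ae_of_all _ fun x => by rw [hφ]; exact hK' _ _)
    have hiter : ∀ i, ∫ x, φ (shift^[i] x) ∂μ = ∫ x, φ x ∂μ := fun i => by
      have hmp := hinv.iterate i
      conv_rhs => rw [← hmp.map_eq]
      exact (integral_map hmp.measurable.aemeasurable hφc.aestronglyMeasurable).symm
    have hsum : ∀ n : ℕ, -(2 * K) ≤ n * (∫ x, φ x ∂μ - hStar h) := by
      intro n
      have hinti : ∀ i ∈ Finset.range n, Integrable (fun x => φ (shift^[i] x) - hStar h) μ :=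
        fun i _ => ((hinv.iterate i).integrable_comp_of_integrable hint).sub
          (integrable_const _)
      have h1 : ∫ x, ∑ i ∈ Finset.range n, (φ (shift^[i] x) - hStar h) ∂μ
          = n * (∫ x, φ x ∂μ - hStar h) := by
        have h0 : ∀ i, ∫ x, (φ (shift^[i] x) - hStar h) ∂μ = ∫ x, φ x ∂μ - hStar h := fun i =>
          (integral_sub ((hinv.iterate i).integrable_comp_of_integrable hint)
            (integrable_const _)).trans (by simp [hiter])
        rw [integral_finsetSum _ hinti, Finset.sum_congr rfl (fun i _ => h0 i),
          Finset.sum_const, Finset.card_range, nsmul_eq_mul]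
      rw [← h1]
      have h2 : ∀ x, -(2 * K) ≤ ∑ i ∈ Finset.range n, (φ (shift^[i] x) - hStar h) := by
        intro x
        have := hg.neg_le_sum_path hle x n (C := 2 * K) (by positivity) (fun b => by
          have h3 := (abs_le.1 (hK' b (x 0))).2
          have h4 := (abs_le.1 (hK' b (x n))).1
          linarith)
        simpa only [hφ, shift_iterate_apply, add_zero] using this
      calc -(2 * K) = ∫ _, -(2 * K) ∂μ := by simp
        _ ≤ _ := integral_mono (integrable_const _) (integrable_finsetSum _ hinti) h2
    by_contra hlt
    push Not at hlt
    obtain ⟨n, hn⟩ := exists_nat_gt (2 * K / (hStar h - ∫ x, φ x ∂μ))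
    rw [div_lt_iff₀ (by linarith)] at hn
    linarith [hsum n]
  have hval : ∫ x, φ x ∂(Measure.dirac (const a)) = hStar h := by
    rw [integral_dirac, hφ]
    exact ha
  refine le_antisymm ?_ ?_
  · exact hval ▸ csInf_le ⟨hStar h, by rintro _ ⟨μ, hμ, rfl⟩; exact hlow μ hμ⟩ ⟨_, hdirac, rfl⟩
  · refine le_csInf ⟨_, _, hdirac, rfl⟩ ?_
    rintro _ ⟨μ, hμ, rfl⟩
    exact hlow μ hμ

/-! ### Semi-static orbits -/

/-- An orbit segment that leads from near `x` to near `shift^[m] x` costs, for small `ε`, almost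
as much as the segment of `x` of length `m`. One shorter than `m` shadows a return of the orbit of
`x` to `shift^[m] x`, which `hx` covers; in a longer one the part after time `m` is nearly a
cycle, whose cost is almost nonnegative. -/
theorem eventually_le_maneEps {h : ℝ → ℝ → ℝ} {φ : X → ℝ} (hφ : ∀ x, φ x = h (x 0) (x 1))
    (hc : Continuous fun p : unitInterval × unitInterval => h p.1 p.2)
    (hg : StrictExchange fun a b : unitInterval => h a b) (x : X) (m : ℕ)
    (hx : ∀ n < m, shift^[n] x = shift^[m] x →
      ∑ i ∈ Finset.range n, (φ (shift^[i] x) - alpha φ)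
        = ∑ i ∈ Finset.range m, (φ (shift^[i] x) - alpha φ))
    {δ : ℝ} (hδ : 0 < δ) :
    ∀ᶠ ε in 𝓝[>] (0 : ℝ),
      ((∑ i ∈ Finset.range m, (φ (shift^[i] x) - alpha φ) - δ : ℝ) : EReal)
        ≤ maneEps φ x (shift^[m] x) ε := by
  have hle := (exists_mem_mSet hc).2
  simp only [alpha_eq_hStar hφ hc hg, hφ, shift_iterate_apply, add_zero] at hx ⊢
  set c := hStar h
  set θ : ℝ := δ / (m + 1) with hθ
  have hθ0 : 0 < θ := by positivity
  have hmθ : m * θ + θ = δ := by rw [hθ]; field_simp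
  obtain ⟨η, hη, huc⟩ := Metric.uniformContinuous_iff.1
    (CompactSpace.uniformContinuous_of_continuous hc) θ hθ0
  have hclose : ∀ a b a' b' : unitInterval, |(a : ℝ) - a'| < η → |(b : ℝ) - b'| < η →
      h a b < h a' b' + θ := by
    intro a b a' b' h1 h2
    have := @huc (a, b) (a', b') (by
      rw [Prod.dist_eq, max_lt_iff]
      exact ⟨h1, h2⟩)
    rw [Real.dist_eq, abs_lt] at this
    linarith [this.2]
  have hsmall : ∀ r : ℝ, 0 < r → ∀ k : ℕ, ∀ᶠ ε in 𝓝[>] (0 : ℝ), 2 ^ k * ε < r := by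
    intro r hr k
    have : Tendsto (fun ε : ℝ => 2 ^ k * ε) (𝓝[>] 0) (𝓝 0) := by
      have := (continuous_const_mul ((2 : ℝ) ^ k)).tendsto 0
      rw [mul_zero] at this
      exact this.mono_left nhdsWithin_le_nhds
    exact this.eventually_lt_const hr
  have hshort : ∀ᶠ ε in 𝓝[>] (0 : ℝ), ∀ n ∈ Finset.range m,
      shift^[n] x ≠ shift^[m] x → B x (shift^[m] x) n ε = ∅ := by
    rw [Filter.eventually_all_finset]
    intro n _
    by_cases hne : shift^[n] x = shift^[m] x
    · exact Eventually.of_forall fun ε h => absurd hne h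
    obtain ⟨k, hk⟩ := Function.ne_iff.1 hne
    rw [shift_iterate_apply, shift_iterate_apply] at hk
    have hk' : 0 < |(x (n + k) : ℝ) - x (m + k)| :=
      abs_pos.2 (sub_ne_zero.2 fun h => hk (Subtype.ext h))
    filter_upwards [hsmall _ (half_pos hk') (n + k + 1), hsmall _ (half_pos hk') (k + 1)]
      with ε h1 h2 _
    refine Set.eq_empty_of_forall_notMem fun z hz => ?_
    have h3 := abs_sub_le_dX x z (n + k)
    have h4 := abs_sub_le_dX (shift^[n] z) (shift^[m] x) k
    rw [shift_iterate_apply, shift_iterate_apply] at h4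
    have h5 : 2 ^ (n + k + 1) * dX x z ≤ 2 ^ (n + k + 1) * ε :=
      mul_le_mul_of_nonneg_left hz.1.le (by positivity)
    have h6 : 2 ^ (k + 1) * dX (shift^[n] z) (shift^[m] x) ≤ 2 ^ (k + 1) * ε :=
      mul_le_mul_of_nonneg_left hz.2.le (by positivity)
    have h7 := abs_sub_le (x (n + k) : ℝ) (z (n + k)) (x (m + k))
    linarith
  filter_upwards [hshort, hsmall _ (half_pos hη) (m + 1), self_mem_nhdsWithin]
    with ε hsh hε hε0
  refine le_sInf ?_
  rintro s ⟨n, -, z, hz, rfl⟩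
  rw [EReal.coe_le_coe_iff]
  simp only [alpha_eq_hStar hφ hc hg, hφ, shift_iterate_apply, add_zero]
  have hzx : ∀ k ≤ m, |(x k : ℝ) - z k| < η / 2 := by
    intro k hk
    calc |(x k : ℝ) - z k| ≤ 2 ^ (k + 1) * dX x z := abs_sub_le_dX x z k
      _ ≤ 2 ^ (k + 1) * ε := mul_le_mul_of_nonneg_left hz.1.le (by positivity)
      _ ≤ 2 ^ (m + 1) * ε := mul_le_mul_of_nonneg_right
          (pow_le_pow_right₀ (by norm_num) (by omega)) (le_of_lt hε0)
      _ < η / 2 := hε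
  have hsum : ∀ l ≤ m, ∑ i ∈ Finset.range l, (h (x i) (x (i + 1)) - c) - m * θ
      ≤ ∑ i ∈ Finset.range l, (h (z i) (z (i + 1)) - c) := by
    intro l hl
    have h1 : ∑ i ∈ Finset.range l, (h (x i) (x (i + 1)) - c)
        ≤ ∑ i ∈ Finset.range l, (h (z i) (z (i + 1)) - c + θ) := by
      refine Finset.sum_le_sum fun i hi => ?_
      have := Finset.mem_range.1 hi
      have := hclose _ _ _ _ ((hzx i (by omega)).trans (half_lt_self hη))
        ((hzx (i + 1) (by omega)).trans (half_lt_self hη))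
      linarith
    rw [Finset.sum_add_distrib, Finset.sum_const, Finset.card_range, nsmul_eq_mul] at h1
    have h2 : (l : ℝ) * θ ≤ m * θ :=
      mul_le_mul_of_nonneg_right (by exact_mod_cast hl) hθ0.le
    linarith
  rcases lt_or_ge n m with hnm | hnm
  · have hret : shift^[n] x = shift^[m] x := by
      by_contra hne
      rw [hsh n (Finset.mem_range.2 hnm) hne] at hz
      exact hz
    rw [← hx n hnm hret]
    change _ ≤ ∑ i ∈ Finset.range n, (h (z i) (z (i + 1)) - c)
    linarith [hsum n hnm.le]
  · obtain ⟨l, rfl⟩ := Nat.exists_eq_add_of_le hnm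
    have h1 := abs_sub_le_dX (shift^[m + l] z) (shift^[m] x) 0
    rw [shift_iterate_apply, shift_iterate_apply, add_zero, add_zero] at h1
    have h2 : |(z (m + l) : ℝ) - x m| < η / 2 := by
      calc _ ≤ _ := h1
        _ ≤ 2 ^ (0 + 1) * ε := mul_le_mul_of_nonneg_left hz.2.le (by positivity)
        _ ≤ 2 ^ (m + 1) * ε := mul_le_mul_of_nonneg_right
          (pow_le_pow_right₀ (by norm_num) (by omega)) (le_of_lt hε0)
        _ < η / 2 := hε
    have h3 : |(z m : ℝ) - z (m + l)| < η := by
      have h4 := abs_sub_le (z m : ℝ) (x m) (z (m + l))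
      rw [abs_sub_comm (z m : ℝ) (x m), abs_sub_comm (x m : ℝ) (z (m + l))] at h4
      linarith [hzx m le_rfl]
    have h5 := hg.neg_le_sum_path hle (fun i => z (m + i)) l hθ0.le
      (fun a => (hclose a _ a _ (by simpa using hη) h3).le)
    rw [Finset.sum_range_add]
    have h6 := hsum m le_rfl
    simp only [← add_assoc] at h5 ⊢
    linarith

/-- An orbit is semi-static as soon as all the cycles it contains have zero action. -/
theorem semiStatic_of_cycles {h : ℝ → ℝ → ℝ} {φ : X → ℝ} (hφ : ∀ x, φ x = h (x 0) (x 1))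
    (hc : Continuous fun p : unitInterval × unitInterval => h p.1 p.2)
    (hg : StrictExchange fun a b : unitInterval => h a b) {x : X}
    (hx : ∀ k j, k < j → shift^[k] x = shift^[j] x →
      ∑ n ∈ Finset.Ico k j, (φ (shift^[n] x) - alpha φ) = 0) :
    SemiStatic φ x := by
  intro i j hij
  obtain ⟨m, hm, rfl⟩ : ∃ m, 1 ≤ m ∧ j = m + i := ⟨j - i, by omega, by omega⟩
  have hS : ∀ l, ∑ n ∈ Finset.Ico i (l + i), (φ (shift^[n] x) - alpha φ)
      = ∑ n ∈ Finset.range l, (φ (shift^[n] (shift^[i] x)) - alpha φ) := by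
    intro l
    rw [Finset.sum_Ico_eq_sum_range, Nat.add_sub_cancel]
    simp only [← shift_iterate_add, add_comm]
  rw [hS m, shift_iterate_add]
  refine le_antisymm ?_ ?_
  · refine EReal.ge_of_forall_gt_iff_ge.1 fun r hr => ?_
    refine ge_of_tendsto (tendsto_maneEps φ _ _) ?_
    have := eventually_le_maneEps hφ hc hg (shift^[i] x) m ?_
      (sub_pos.2 (EReal.coe_lt_coe_iff.1 hr))
    · filter_upwards [this] with ε hε
      rwa [sub_sub_cancel] at hε
    · intro l hl hlx
      rw [← hS l, ← hS m, ← Finset.sum_Ico_consecutive _ (Nat.le_add_left i l)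
        (Nat.add_le_add_right hl.le i), hx (l + i) (m + i) (by omega)
        (by rw [shift_iterate_add, hlx, shift_iterate_add]), add_zero]
  · refine le_of_tendsto (tendsto_maneEps φ _ _) ?_
    filter_upwards [self_mem_nhdsWithin] with ε hε
    have hε : 0 < ε := hε
    exact sInf_le ⟨m, hm, shift^[i] x, ⟨by rwa [dX_self], by rwa [dX_self]⟩, rfl⟩

theorem SemiStatic.shift_iterate {φ : X → ℝ} {x : X} (hx : SemiStatic φ x) (k : ℕ) :
    SemiStatic φ (shift^[k] x) := by
  intro i j hij
  simp only [← shift_iterate_add]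
  rw [← hx (i + k) (j + k) (by omega),
    ← Finset.sum_Ico_add' (fun n => φ (shift^[n] x) - alpha φ)]

theorem maneSet_eq_setOf_semiStatic (φ : X → ℝ) : maneSet φ = {x | SemiStatic φ x} := by
  ext y
  constructor
  · rintro ⟨x, k, hx, rfl⟩
    exact hx.shift_iterate k
  · exact fun hy => ⟨y, 0, hy, rfl⟩

/-- A cycle in a semi-static orbit has zero action: running through it once or twice connects the
same two points, hence costs the same. -/
theorem SemiStatic.sum_cycle_eq_zero {φ : X → ℝ} {x : X} (hx : SemiStatic φ x) {i p : ℕ}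
    (hp : 0 < p) (hip : shift^[p + i] x = shift^[i] x) :
    ∑ n ∈ Finset.Ico (p + i) (p + (p + i)), (φ (shift^[n] x) - alpha φ) = 0 := by
  have h1 := hx i (p + i) (by omega)
  have h2 := hx i (p + (p + i)) (by omega)
  rw [shift_iterate_add x p (p + i), hip, ← shift_iterate_add, ← h1, EReal.coe_eq_coe_iff,
    ← Finset.sum_Ico_consecutive _ (show i ≤ p + i by omega)
      (show p + i ≤ p + (p + i) by omega)] at h2
  linarith

/-- A periodic point whose cycle has zero action is a fixed point `a^∞` with `a ∈ mSet h`. -/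
theorem eq_const_of_sum_cycle_eq_zero {h : ℝ → ℝ → ℝ}
    (hc : Continuous fun p : unitInterval × unitInterval => h p.1 p.2)
    (hg : StrictExchange fun a b : unitInterval => h a b) {y : X} {p : ℕ} (hp : 0 < p)
    (hy : shift^[p] y = y)
    (hsum : ∑ n ∈ Finset.range p, (h (y n) (y (n + 1)) - hStar h) = 0) :
    ∃ a ∈ mSet h, y = const a := by
  have hle := (exists_mem_mSet hc).2
  have hper : ∀ n, y (n + p) = y n := fun n => by
    rw [add_comm, ← shift_iterate_apply y, hy]
  obtain ⟨h1, h2⟩ := hg.sum_diag_le_sum_cycle y (by simpa using hper 0)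
  have h3 : ∑ n ∈ Finset.range p, hStar h ≤ ∑ n ∈ Finset.range p, h (y n) (y n) :=
    Finset.sum_le_sum fun n _ => hle _
  rw [Finset.sum_sub_distrib] at hsum
  have hstep := h2 (by linarith)
  have hconst : ∀ n, n < p → y n = y 0 := by
    intro n
    induction n with
    | zero => exact fun _ => rfl
    | succ n ih => exact fun hn => (hstep n (by omega)).trans (ih (by omega))
  have hy0 : y = const (y 0) := by
    funext n
    rw [← Function.Periodic.map_mod_nat (f := y) hper n]
    exact hconst _ (Nat.mod_lt n hp)
  refine ⟨y 0, le_antisymm ?_ (hle _), hy0⟩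
  have h4 : ∑ n ∈ Finset.range p, h (y n) (y n) = p * h (y 0) (y 0) := by
    rw [Finset.sum_congr rfl fun n hn => by rw [hconst n (Finset.mem_range.1 hn)],
      Finset.sum_const, Finset.card_range, nsmul_eq_mul]
  rw [Finset.sum_const, Finset.card_range, nsmul_eq_mul] at hsum
  have hp' : (0 : ℝ) < p := by exact_mod_cast hp
  exact le_of_mul_le_mul_left (by linarith) hp'

theorem maneSet_eq {h : ℝ → ℝ → ℝ} {φ : X → ℝ} (hφ : ∀ x, φ x = h (x 0) (x 1))
    (hc : Continuous fun p : unitInterval × unitInterval => h p.1 p.2)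
    (hg : StrictExchange fun a b : unitInterval => h a b) :
    maneSet φ = {x : X | ∀ i j : ℕ, i ≠ j → shift^[i] x ≠ shift^[j] x} ∪
      ⋃ M : ℕ, shift^[M] ⁻¹' {y | ∃ a ∈ mSet h, y = const a} := by
  rw [maneSet_eq_setOf_semiStatic]
  ext x
  simp only [Set.mem_ofPred_eq, Set.mem_union, Set.mem_iUnion, Set.mem_preimage]
  constructor
  · intro hx
    by_contra! hcon
    obtain ⟨⟨i, j, hij, heq⟩, hfix⟩ := hcon
    wlog hlt : i < j generalizing i j
    · exact this j i hij.symm heq.symm (by omega)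
    obtain ⟨p, hp, rfl⟩ : ∃ p, 0 < p ∧ j = p + i := ⟨j - i, by omega, by omega⟩
    have hsum := hx.sum_cycle_eq_zero hp heq.symm
    rw [Finset.sum_Ico_eq_sum_range, Nat.add_sub_cancel] at hsum
    simp only [alpha_eq_hStar hφ hc hg, hφ, shift_iterate_apply, add_zero] at hsum
    obtain ⟨a, ha, hxa⟩ := eq_const_of_sum_cycle_eq_zero hc hg (y := shift^[p + i] x) hp
      (by rw [← shift_iterate_add, shift_iterate_add, ← heq, ← shift_iterate_add, heq])
      (by simpa only [shift_iterate_apply, ← add_assoc] using hsum)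
    exact hfix (p + i) a ha hxa
  · rintro (hx | ⟨M, a, ha, hM⟩)
    · exact semiStatic_of_cycles hφ hc hg fun k j hkj heq => absurd heq (hx k j hkj.ne)
    · refine semiStatic_of_cycles hφ hc hg fun k j hkj heq => ?_
      obtain ⟨p, hp, rfl⟩ : ∃ p, 0 < p ∧ j = p + k := ⟨j - k, by omega, by omega⟩
      -- An orbit that returns never leaves its cycle, so it has reached `a^∞` already.
      have hk : shift^[k] x = const a := by
        have hret : ∀ q, shift^[p * q] (shift^[k] x) = shift^[k] x := fun q => by
          rw [Function.iterate_mul]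
          exact Function.iterate_fixed (by rw [← shift_iterate_add, ← heq]) q
        obtain ⟨r, hr⟩ := Nat.exists_eq_add_of_le
          (show M ≤ p * M + k from (Nat.le_mul_of_pos_left M hp).trans (Nat.le_add_right _ _))
        rw [← hret M, ← shift_iterate_add, hr, add_comm, shift_iterate_add, hM,
          shift_iterate_const]
      refine Finset.sum_eq_zero fun n hn => ?_
      obtain ⟨l, rfl⟩ := Nat.exists_eq_add_of_le (Finset.mem_Ico.1 hn).1
      rw [add_comm, shift_iterate_add, hk, shift_iterate_const, hφ, alpha_eq_hStar hφ hc hg]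
      exact sub_eq_zero.2 ha

theorem dense_iUnion_preimage_const {m : Set unitInterval} (hm : m.Nonempty) :
    Dense (⋃ M : ℕ, shift^[M] ⁻¹' {y | ∃ a ∈ m, y = const a}) := by
  obtain ⟨a, ha⟩ := hm
  intro x
  set u : ℕ → X := fun M i => if i < M then x i else a with hu
  have hux : Tendsto u atTop (𝓝 x) := by
    refine tendsto_pi_nhds.2 fun i => tendsto_const_nhds.congr' ?_
    filter_upwards [eventually_gt_atTop i] with M hM
    simp [hu, hM]
  refine mem_closure_of_tendsto hux (Eventually.of_forall fun M => ?_)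
  refine Set.mem_iUnion.2 ⟨M, a, ha, ?_⟩
  funext i
  rw [shift_iterate_apply]
  simp [hu, const]

/-! ### The two classes of functions -/

theorem continuous_of_continuousOn_square {h : ℝ → ℝ → ℝ}
    (hc : ContinuousOn (fun p : ℝ × ℝ => h p.1 p.2) square) :
    Continuous fun p : unitInterval × unitInterval => h p.1 p.2 :=
  hc.comp_continuous (f := fun p : unitInterval × unitInterval => ((p.1 : ℝ), (p.2 : ℝ)))
    (by fun_prop) fun p => ⟨p.1.2, p.2.2⟩

/-- A negative mixed derivative makes `s ↦ h s η₂ - h s η₁` strictly decreasing for `η₁ < η₂`,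
which is the exchange inequality. -/
theorem TwistC2.strictExchange {h : ℝ → ℝ → ℝ} (hh : TwistC2 h) :
    StrictExchange fun a b : unitInterval => h a b := by
  obtain ⟨hC, hneg⟩ := hh
  intro ξ₁ ξ₂ η₁ η₂ hξ hη
  have hdiff : ∀ t ∈ Set.Icc (0 : ℝ) 1, DifferentiableOn ℝ (fun s => h s t) (Set.Icc 0 1) := by
    intro t ht
    exact (hC.differentiableOn (by norm_num)).comp (g := fun p : ℝ × ℝ => h p.1 p.2)
      (f := fun s : ℝ => (s, t)) (by fun_prop) fun s hs => ⟨hs, ht⟩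
  have hanti : ∀ s ∈ Set.Icc (0 : ℝ) 1,
      StrictAntiOn (fun t => derivWithin (fun s => h s t) (Set.Icc 0 1) s) (Set.Icc 0 1) := by
    intro s hs
    refine strictAntiOn_of_deriv_neg (convex_Icc 0 1) ?_ ?_
    · -- A nonzero `derivWithin` is not a junk value, so it entails continuity.
      intro t ht
      exact (differentiableWithinAt_of_derivWithin_ne_zero (hneg s hs t ht).ne).continuousWithinAt
    · intro t ht
      have h1 := hneg s hs t (interior_subset ht)
      rwa [derivWithin_of_mem_nhds (mem_interior_iff_mem_nhds.1 ht)] at h1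
  have hlt : StrictAntiOn (fun s => h s η₂ - h s η₁) (Set.Icc (0 : ℝ) 1) := by
    refine strictAntiOn_of_deriv_neg (convex_Icc 0 1)
      ((hdiff _ η₂.2).sub (hdiff _ η₁.2)).continuousOn ?_
    intro s hs
    have hnhds := mem_interior_iff_mem_nhds.1 hs
    have hd : ∀ t ∈ Set.Icc (0 : ℝ) 1, DifferentiableAt ℝ (fun s => h s t) s :=
      fun t ht => (hdiff t ht).differentiableAt hnhds
    have h1 := hanti s (interior_subset hs) η₁.2 η₂.2 hη
    simp only [derivWithin_of_mem_nhds hnhds] at h1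
    rw [deriv_fun_sub (hd _ η₂.2) (hd _ η₁.2)]
    linarith
  have := hlt ξ₁.2 ξ₂.2 hξ
  simp only at this
  linarith

theorem twistC2_neg_mul : TwistC2 fun s t => -(s * t) := by
  refine ⟨(contDiff_fst.mul contDiff_snd).neg.contDiffOn, fun x hx y hy => ?_⟩
  have hU : UniqueDiffOn ℝ (Set.Icc (0 : ℝ) 1) := uniqueDiffOn_Icc_zero_one
  have h1 : ∀ t : ℝ, derivWithin (fun s : ℝ => -(s * t)) (Set.Icc 0 1) x = -t := fun t => by
    exact (hasDerivAt_mul_const (x := x) t).neg.hasDerivWithinAt.derivWithin (hU x hx)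
  simp only [h1]
  exact ((hasDerivAt_id y).neg.hasDerivWithinAt.derivWithin (hU y hy)).trans_lt (by norm_num)

end XYModel

theorem theoremC :
    (∀ (h : ℝ → ℝ → ℝ) (φ : XYModel.X → ℝ),
      (XYModel.TwistC2 h ∨ XYModel.TwistLip h) →
      (∀ x : XYModel.X, φ x = h (x 0) (x 1)) →
        XYModel.maneSet φ =
            {x : XYModel.X | ∀ i j : ℕ, i ≠ j → XYModel.shift^[i] x ≠ XYModel.shift^[j] x} ∪
              ⋃ M : ℕ, XYModel.shift^[M] ⁻¹' {y | ∃ a ∈ XYModel.mSet h, y = XYModel.const a}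
          ∧ Dense (XYModel.maneSet φ)) ∧
    (∃ (h : ℝ → ℝ → ℝ) (φ : XYModel.X → ℝ),
      XYModel.TwistC2 h ∧ (∀ x : XYModel.X, φ x = h (x 0) (x 1)) ∧
        ¬ IsClosed (XYModel.maneSet φ)) := by
  have key : ∀ (h : ℝ → ℝ → ℝ) (φ : XYModel.X → ℝ),
      (XYModel.TwistC2 h ∨ XYModel.TwistLip h) →
      (∀ x : XYModel.X, φ x = h (x 0) (x 1)) →
        XYModel.maneSet φ =
            {x : XYModel.X | ∀ i j : ℕ, i ≠ j → XYModel.shift^[i] x ≠ XYModel.shift^[j] x} ∪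
              ⋃ M : ℕ, XYModel.shift^[M] ⁻¹' {y | ∃ a ∈ XYModel.mSet h, y = XYModel.const a}
          ∧ Dense (XYModel.maneSet φ) := by
    intro h φ hh hφ
    have hc : Continuous fun p : unitInterval × unitInterval => h p.1 p.2 := by
      rcases hh with hh | hh
      · exact XYModel.continuous_of_continuousOn_square hh.1.continuousOn
      · obtain ⟨K, hK⟩ := hh.1
        exact XYModel.continuous_of_continuousOn_square hK.continuousOn
    have hg : XYModel.StrictExchange fun a b : unitInterval => h a b := by
      rcases hh with hh | hh
      · exact hh.strictExchange
      · exact hh.2.1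
    have heq := XYModel.maneSet_eq hφ hc hg
    refine ⟨heq, heq ▸ ?_⟩
    exact (XYModel.dense_iUnion_preimage_const (XYModel.exists_mem_mSet hc).1).mono
      Set.subset_union_right
  refine ⟨key, fun s t => -(s * t), fun x => -((x 0 : ℝ) * x 1), XYModel.twistC2_neg_mul,
    fun _ => rfl, fun hclosed => ?_⟩
  -- A closed dense set is everything, but `0^∞` is periodic and `0` does not minimise `-a²`.
  obtain ⟨heq, hdense⟩ := key (fun s t => -(s * t)) (fun x => -((x 0 : ℝ) * x 1))
    (Or.inl XYModel.twistC2_neg_mul) fun _ => rfl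
  have hmem : XYModel.const 0 ∈ XYModel.maneSet fun x => -((x 0 : ℝ) * x 1) := by
    rw [← hclosed.closure_eq, hdense.closure_eq]
    trivial
  rw [heq] at hmem
  rcases hmem with hmem | hmem
  · exact hmem 0 1 zero_ne_one (by simp only [XYModel.shift_iterate_const])
  · obtain ⟨M, a, ha, hM⟩ := Set.mem_iUnion.1 hmem
    rw [XYModel.shift_iterate_const] at hM
    have ha0 : a = 0 := (congrFun hM 0).symm
    have hle := (XYModel.exists_mem_mSet (h := fun s t => -(s * t))
      (XYModel.continuous_of_continuousOn_square (h := fun s t => -(s * t))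
        XYModel.twistC2_neg_mul.1.continuousOn)).2 1
    have ha' : -((a : ℝ) * a) = XYModel.hStar fun s t => -(s * t) := ha
    rw [← ha', ha0] at hle
    norm_num at hle
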